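/- Let $v:[0,1]\to\mathbb{R}$ be Lipschitz with Lipschitz constant $L$, with $v(1)=0$ and $v'(\rho)\le c<0$ for a.e. $\rho\in[0,1]$, for some constant $c$. For $N\ge 1$ let $l=1/N$. A solution of the Follow-the-Leader (FtL) system with $N+1$ vehicles is a family $x^N_0,\dots,x^N_N:[0,+\infty)\to\mathbb{R}$ with $$\dot x^N_j=v\Big(\frac{l}{x^N_{j+1}-x^N_j}\Big)\quad (0\le j\le N-1),\qquad \dot x^N_N=v(0),\qquad x^N_{j+1}(0)-x^N_j(0)\ge l\quad(0\le j\le N-1).$$ Its Eulerian discrete density is $$\rho^{E,N}(t,x)=\sum_{j=0}^{N-1}\frac{l}{x^N_{j+1}(t)-x^N_j(t)}\,\chi_{[x^N_j(t),x^N_{j+1}(t))}(x),\qquad x\in\mathbb{R}.$$ For compactly supported probability measures on $\mathbb{R}$, let $W_1(\mu,\nu)=\|F_\mu-F_\nu\|_{L^1(\mathbb{R})}$ be the 1-Wasserstein distance, with $F_\mu(x)=\mu((-\infty,x])$. For every $N\ge1$ let $\{x^N_j\}_{j=0}^N$ and $\{\tilde x^N_j\}_{j=0}^N$ be solutions of the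 FtL system, with Eulerian discrete densities $\rho^{E,N}$ and $\tilde\rho^{E,N}$, such that the initial positions $x^N_j(0)$ and $\tilde x^N_j(0)$, for all $N$ and $j$, lie in a bounded set independent of $N$. Put $$S_N=\sum_{j=0}^{N-1}\big|x^N_{j+1}(0)-x^N_j(0)-(\tilde x^N_{j+1}(0)-\tilde x^N_j(0))\big|.$$ Then for all $T>0$ and all $N\ge1$ $$\sup_{t\in[0,T]}W_1\big(\rho^{E,N}(t),\tilde\rho^{E,N}(t)\big)\le W_1\big(\rho^{E,N}(0),\tilde\rho^{E,N}(0)\big)+2LT\,S_N.$$ Moreover, if $x^N_N(0)=\tilde x^N_N(0)$ for all $N\ge1$ and $\lim_{N\to\infty}S_N=0$, then: (i) if there is $C>0$ such that the total variations on $\mathbb{R}$ of $\rho^{E,N}(0)$ and of $\tilde\rho^{E,N}(0)$ are less than $C$ for all $N\ge1$, then for all $T>0$ $$\lim_{N\to\infty}\ \sup_{t\in[0,T]}\big\|\rho^{E,N}(t)-\tilde\rho^{E,N}(t)\big\|_{L^1(\mathbb{R})}=0;$$ (ii) if the map $\rho\mapsto\rho\,v'(\rho)$ (defined where $v$ is differentiable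 in $(0,1)$) is non-increasing, then for all $T>0$ there is a strictly increasing sequence $(N_k)_k$ with $$\lim_{k\to\infty}\ \sup_{t\in[1/k,T]}\big\|\rho^{E,N_k}(t)-\tilde\rho^{E,N_k}(t)\big\|_{L^1(\mathbb{R})}=0.$$ -/

import Mathlib

open Set Filter Topology MeasureTheory
open scoped NNReal ENNReal

noncomputable section

/-- Standing assumptions on the velocity map `v` (only its values on `[0, 1]` matter, the maximal
density being `1`): `v` is Lipschitz on `[0, 1]` with Lipschitz constant `L`, `v 1 = 0`, and there
is a constant `c < 0` with `v' ≤ c` almost everywhere on `[0, 1]`.  (`deriv v` is `0` where `v` is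
not differentiable, so the inequality includes differentiability.) -/
structure VelocityAssumption (v : ℝ → ℝ) (L : ℝ≥0) : Prop where
  lipschitz : LipschitzOnWith L v (Icc 0 1)
  map_one : v 1 = 0
  deriv_le : ∃ c : ℝ, c < 0 ∧ ∀ᵐ r ∂(volume.restrict (Icc (0 : ℝ) 1)), deriv v r ≤ c

/-- The additional assumption on the velocity: `ρ ↦ ρ v'(ρ)` is non-increasing on `[0, 1]`, on the
set of the points at which the Lipschitz function `v` has a derivative. -/
def VelocityMonotonicity (v : ℝ → ℝ) : Prop :=
  AntitoneOn (fun r => r * deriv v r) {r | r ∈ Ioo (0 : ℝ) 1 ∧ DifferentiableAt ℝ v r}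

/-- The discrete density `ρ_j = l / (x_{j+1} - x_j)` with `l = 1 / N`, at time `t`. -/
def discreteDensity {N : ℕ} (x : Fin (N + 1) → ℝ → ℝ) (j : Fin N) (t : ℝ) : ℝ :=
  (1 / (N : ℝ)) / (x j.succ t - x j.castSucc t)

/-- Solutions on `[0, +∞)` of the Follow-the-Leader system with `N + 1` vehicles whose initial
positions are ordered and have mutual distances at least `l = 1 / N`.

Since `v` is a map on `[0, 1]`, it is evaluated at the projection of the discrete density to
`[0, 1]`; that the discrete density in fact stays in `[0, 1]` is not assumed. -/
structure IsFtLSolution (v : ℝ → ℝ) (N : ℕ) (x : Fin (N + 1) → ℝ → ℝ) : Prop where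
  initial_gap : ∀ j : Fin N, 1 / (N : ℝ) ≤ x j.succ 0 - x j.castSucc 0
  leader : ∀ t : ℝ, 0 ≤ t → HasDerivWithinAt (x (Fin.last N)) (v 0) (Ici 0) t
  follower : ∀ j : Fin N, ∀ t : ℝ, 0 ≤ t →
    HasDerivWithinAt (x j.castSucc)
      (v (projIcc (0 : ℝ) 1 zero_le_one (discreteDensity x j t))) (Ici 0) t

/-- All initial positions, for all numbers of vehicles, lie in one bounded set. -/
def UniformlyBoundedInitialSupport (x : (N : ℕ) → Fin (N + 1) → ℝ → ℝ) : Prop :=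
  ∃ K : Set ℝ, Bornology.IsBounded K ∧ ∀ N : ℕ, 1 ≤ N → ∀ i : Fin (N + 1), x N i 0 ∈ K

/-- The Eulerian discrete density `ρ^{E,N}(t, ·)`. -/
def eulerianDensity {N : ℕ} (x : Fin (N + 1) → ℝ → ℝ) (t : ℝ) (y : ℝ) : ℝ :=
  ∑ j : Fin N, (Ico (x j.castSucc t) (x j.succ t)).indicator (fun _ => discreteDensity x j t) y

/-- The measure on the real line with density `ρ^{E,N}(t, ·)`. -/
def eulerianMeasure {N : ℕ} (x : Fin (N + 1) → ℝ → ℝ) (t : ℝ) : Measure ℝ :=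
  volume.withDensity (fun y => ENNReal.ofReal (eulerianDensity x t y))

/-- The cumulative distribution `F_μ(y) = μ((-∞, y])`. -/
def cumulative (μ : Measure ℝ) (y : ℝ) : ℝ := μ.real (Iic y)

/-- The one-dimensional 1-Wasserstein distance of two compactly supported probability measures,
`W₁(μ, ν) = ‖F_μ - F_ν‖_{L¹(ℝ)}`. -/
def wassersteinOne (μ ν : Measure ℝ) : ℝ≥0∞ :=
  eLpNorm (fun y => cumulative μ y - cumulative ν y) 1 volume

/-- `W₁(ρ^{E,N}(t), ρ̃^{E,N}(t))`. -/
def wassersteinEulerian {N : ℕ} (x z : Fin (N + 1) → ℝ → ℝ) (t : ℝ) : ℝ≥0∞ :=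
  wassersteinOne (eulerianMeasure x t) (eulerianMeasure z t)

/-- `‖ρ^{E,N}(t) - ρ̃^{E,N}(t)‖_{L¹(ℝ)}`. -/
def lOneEulerian {N : ℕ} (x z : Fin (N + 1) → ℝ → ℝ) (t : ℝ) : ℝ≥0∞ :=
  eLpNorm (fun y => eulerianDensity x t y - eulerianDensity z t y) 1 volume

/-- `∑_{j=0}^{N-1} |x_{j+1}(0) - x_j(0) - (x̃_{j+1}(0) - x̃_j(0))|`. -/
def initialGapDifference {N : ℕ} (x z : Fin (N + 1) → ℝ → ℝ) : ℝ :=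
  ∑ j : Fin N, |x j.succ 0 - x j.castSucc 0 - (z j.succ 0 - z j.castSucc 0)|

/-- The total variation on `ℝ` of `ρ^{E,N}(0, ·)`. -/
def initialTotalVariation {N : ℕ} (x : Fin (N + 1) → ℝ → ℝ) : ℝ≥0∞ :=
  eVariationOn (eulerianDensity x 0) univ

end

/-!
For two solutions with the same `N`, the follower of a gap reacts to that gap monotonically, so
each difference of gaps loses at least as much as its neighbour gains: the differences of the gaps
contract in `ℓ¹`, and `S_N` bounds them for all times.

The monotone coupling by the labels `(j, θ)`, with the interpolated position
`x_j + θ (x_{j+1} - x_j)`, realises `W₁`. The speeds of corresponding vehicles differ by at most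
`L N S_N` in `ℓ¹`, and each label carries mass `1 / N`, whence the Wasserstein estimate.

If the leaders start together, corresponding vehicles stay within `S_N` of each other, and the `L¹`
distance of the densities is at most `(M + 1) S_N`, where `M` bounds the variation of one of them.
In (i) `M` is the initial variation, since the variation does not increase. In (ii) it comes from
the discrete one-sided Lipschitz estimate `t (v(ρ_{j+1}) - v(ρ_j)) ≤ x_{j+1} - x_j`: the speeds
increase along the platoon by at most its length divided by `t`, which also controls their
decrease. The estimate propagates backwards from the leader: as long as `s ρ_{j+1}(s)` is
non-decreasing, a gap `g` satisfies `s g'(s) ≤ g(s)`, so that `s ρ_j(s)` is non-decreasing too.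
-/

section Calculus

theorem sub_le_mul_of_ae_deriv_le {f : ℝ → ℝ} {K : ℝ≥0} {a b c : ℝ}
    (hf : LipschitzOnWith K f (Icc a b)) (hab : a ≤ b)
    (hc : ∀ᵐ x ∂volume.restrict (Ioo a b), deriv f x ≤ c) :
    f b - f a ≤ c * (b - a) := by
  rw [← uIcc_of_le hab] at hf
  have hac := hf.absolutelyContinuousOnInterval
  rw [Measure.restrict_congr_set Ioo_ae_eq_Icc] at hc
  calc f b - f a = ∫ x in a..b, deriv f x := hac.integral_deriv_eq_sub.symm
    _ ≤ ∫ _ in a..b, c := intervalIntegral.integral_mono_ae_restrict hab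
        hac.intervalIntegrable_deriv intervalIntegrable_const hc
    _ = c * (b - a) := by rw [intervalIntegral.integral_const, smul_eq_mul, mul_comm]

theorem ae_comp_mul_left {p : ℝ → Prop} (hp : ∀ᵐ x, p x) {a : ℝ} (ha : a ≠ 0) :
    ∀ᵐ x, p (a * x) := by
  have h := Real.volume_preimage_mul_left ha {x | ¬p x}
  rwa [ae_iff.1 hp, mul_zero] at h

/-- The right derivative of `|f|` at a point where `f` has value `a` and right derivative `a'`. -/
noncomputable def rightDerivAbs (a a' : ℝ) : ℝ := if a = 0 then |a'| else SignType.sign a * a'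

theorem rightDerivAbs_le_abs (a a' : ℝ) : rightDerivAbs a a' ≤ |a'| := by
  rcases lt_trichotomy a 0 with ha | rfl | ha
  · simpa [rightDerivAbs, ha, ha.ne] using neg_le_abs a'
  · simp [rightDerivAbs]
  · simpa [rightDerivAbs, ha, ha.ne'] using le_abs_self a'

theorem rightDerivAbs_sub_le {a p q : ℝ} (hq : SignType.sign a * q = |q|) :
    rightDerivAbs a (p - q) ≤ |p| - |q| := by
  rcases eq_or_ne a 0 with rfl | ha
  · have hq0 : q = 0 := by simpa using hq.symm
    simp [rightDerivAbs, hq0]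
  · have hp := rightDerivAbs_le_abs a p
    rw [rightDerivAbs, if_neg ha] at hp ⊢
    linarith [mul_sub (SignType.sign a : ℝ) p q]

theorem hasDerivWithinAt_abs_Ici {f : ℝ → ℝ} {f' s : ℝ} (hf : HasDerivWithinAt f f' (Ici s) s) :
    HasDerivWithinAt (fun r => |f r|) (rightDerivAbs (f s) f') (Ici s) s := by
  by_cases h0 : f s = 0
  · rw [← hasDerivWithinAt_Ioi_iff_Ici, hasDerivWithinAt_iff_tendsto_slope' self_notMem_Ioi]
      at hf ⊢
    rw [rightDerivAbs, if_pos h0]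
    refine hf.abs.congr' ?_
    filter_upwards [self_mem_nhdsWithin] with r hr
    have hrs : 0 < r - s := sub_pos.2 hr
    simp only [slope_def_field, h0, abs_zero, sub_zero, abs_div, abs_of_pos hrs]
  · rw [rightDerivAbs, if_neg h0]
    exact (hasDerivAt_abs h0).comp_hasDerivWithinAt s hf

theorem le_add_mul_of_right_deriv_le {f f' : ℝ → ℝ} {K t : ℝ} (hf : ContinuousOn f (Ici 0))
    (hd : ∀ s, 0 ≤ s → HasDerivWithinAt f (f' s) (Ici s) s) (hK : ∀ s, 0 ≤ s → f' s ≤ K)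
    (ht : 0 ≤ t) : f t ≤ f 0 + K * t :=
  image_le_of_deriv_right_le_deriv_boundary (B := fun s => f 0 + K * s) (B' := fun _ => K)
    (hf.mono Icc_subset_Ici_self) (fun s hs => hd s hs.1) (by simp) (by fun_prop)
    (fun s _ => ((hasDerivAt_const_mul K).const_add (f 0)).hasDerivWithinAt)
    (fun s hs => hK s hs.1) (right_mem_Icc.2 ht)

theorem sum_abs_le_add_mul {ι : Type*} [Fintype ι] {d d' : ℝ → ι → ℝ} {K t : ℝ}
    (hd : ∀ s, 0 ≤ s → HasDerivWithinAt d (d' s) (Ici 0) s)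
    (hK : ∀ s, 0 ≤ s → ∑ i, rightDerivAbs (d s i) (d' s i) ≤ K) (ht : 0 ≤ t) :
    ∑ i, |d t i| ≤ ∑ i, |d 0 i| + K * t := by
  have hd' (i : ι) (s : ℝ) (hs : 0 ≤ s) : HasDerivWithinAt (d · i) (d' s i) (Ici 0) s :=
    hasDerivWithinAt_pi.1 (hd s hs) i
  refine le_add_mul_of_right_deriv_le
    (continuousOn_finsetSum _ fun i _ s hs => (hd' i s hs).continuousWithinAt.abs)
    (fun s hs => HasDerivWithinAt.fun_sum fun i _ => ?_) hK ht
  exact hasDerivWithinAt_abs_Ici ((hd' i s hs).mono (Ici_subset_Ici.2 hs))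

theorem le_of_deriv_nonneg_below {f f' : ℝ → ℝ} {m l t : ℝ} (hm : m < l)
    (hf : ∀ s, 0 ≤ s → HasDerivWithinAt f (f' s) (Ici 0) s)
    (hf' : ∀ s, 0 ≤ s → f s ∈ Ioo m l → 0 ≤ f' s) (h0 : l ≤ f 0) (ht : 0 ≤ t) : l ≤ f t := by
  by_contra! hlt
  set k := max m (f t)
  obtain ⟨ε, hε, hεk⟩ : ∃ ε > 0, ε * (1 + t) < l - k := by
    have hk : 0 < l - k := sub_pos.2 (max_lt hm hlt)
    refine ⟨(l - k) / (2 + t), by positivity, ?_⟩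
    rw [div_mul_eq_mul_div, div_lt_iff₀ (by positivity)]
    gcongr
    norm_num
  have hbarrier := image_le_of_deriv_right_lt_deriv_boundary' (f := fun s => -f s)
    (f' := fun s => -f' s) (B := fun s => ε * (1 + s) - l) (B' := fun _ => ε) (a := 0) (b := t)
    (fun s hs => ((hf s hs.1).continuousWithinAt.mono Icc_subset_Ici_self).neg)
    (fun s hs => ((hf s hs.1).mono (Ici_subset_Ici.2 hs.1)).neg) (by linarith) (by fun_prop)
    (fun s _ => by
      simpa using ((((hasDerivAt_id s).const_add 1).const_mul ε).sub_const l).hasDerivWithinAt)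
    (fun s hs hfs => ?_) (right_mem_Icc.2 ht)
  · linarith [le_max_right m (f t)]
  · have h1 : ε * (1 + s) ≤ ε * (1 + t) := by gcongr; exact hs.2.le
    have h2 : 0 < ε * (1 + s) := mul_pos hε (by linarith [hs.1])
    linarith [hf' s hs.1 ⟨by linarith [le_max_left m (f t)], by linarith⟩]

theorem mul_le_mul_of_mul_deriv_le {f f' : ℝ → ℝ} {a b : ℝ} (ha : 0 < a) (hab : a ≤ b)
    (hf : ∀ s, 0 < s → HasDerivAt f (f' s) s) (h : ∀ s ∈ Ioo a b, s * f' s ≤ f s) :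
    a * f b ≤ b * f a := by
  have hdiv (s : ℝ) (hs : 0 < s) : HasDerivAt (fun s => f s / s) ((f' s * s - f s) / s ^ 2) s := by
    simpa using (hf s hs).fun_div (hasDerivAt_id s) hs.ne'
  have hanti : AntitoneOn (fun s => f s / s) (Icc a b) := by
    refine antitoneOn_of_hasDerivWithinAt_nonpos (convex_Icc a b)
      (fun s hs => (hdiv s (ha.trans_le hs.1)).continuousAt.continuousWithinAt)
      (fun s hs => (hdiv s (ha.trans_le (interior_subset hs).1)).hasDerivWithinAt)
      fun s hs => div_nonpos_of_nonpos_of_nonneg ?_ (sq_nonneg s)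
    rw [interior_Icc] at hs
    linarith [h s hs]
  have := hanti (left_mem_Icc.2 hab) (right_mem_Icc.2 hab) hab
  rw [div_le_div_iff₀ (ha.trans_le hab) ha] at this
  linarith

theorem exists_nonpos_forall_Ioc_pos {q : ℝ → ℝ} {a b : ℝ} (hq : ContinuousOn q (Icc a b))
    (hab : a ≤ b) (ha : q a ≤ 0) (hb : 0 < q b) :
    ∃ c ∈ Ico a b, q c ≤ 0 ∧ ∀ s ∈ Ioc c b, 0 < q s := by
  have hclosed : IsClosed (Icc a b ∩ q ⁻¹' Iic 0) :=
    hq.preimage_isClosed_of_isClosed isClosed_Icc isClosed_Iic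
  obtain ⟨c, ⟨hc, hqc⟩, hmax⟩ :=
    (isCompact_Icc.of_isClosed_subset hclosed inter_subset_left).exists_isGreatest
      ⟨a, left_mem_Icc.2 hab, ha⟩
  have hcb : c < b := hc.2.lt_of_ne fun h => (h ▸ hqc : q b ≤ 0).not_gt hb
  refine ⟨c, ⟨hc.1, hcb⟩, hqc, fun s hs => ?_⟩
  by_contra! hqs
  exact hs.1.not_ge (hmax ⟨⟨hc.1.trans hs.1.le, hs.2⟩, hqs⟩)

theorem mul_deriv_sub_le_of_antitoneOn_deriv {g g' : ℝ → ℝ} {a b : ℝ} (ha : 0 ≤ a) (hab : a ≤ b)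
    (hg : ∀ s ∈ Icc a b, HasDerivAt g (g' s) s) (hg' : AntitoneOn g' (Icc a b)) :
    b * g' b - g b ≤ a * g' a - g a := by
  have hb : b ∈ Icc a b := right_mem_Icc.2 hab
  have hconcave : g' b * (b - a) ≤ g b - g a := by
    refine (convex_Icc a b).mul_sub_le_image_sub_of_le_deriv
      (fun s hs => (hg s hs).continuousAt.continuousWithinAt)
      (fun s hs => (hg s (interior_subset hs)).differentiableAt.differentiableWithinAt)
      (fun s hs => ?_) a (left_mem_Icc.2 hab) b hb hab
    have hs := interior_subset hs
    rw [(hg s hs).deriv]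
    exact hg' hs hb hs.2
  linarith [mul_le_mul_of_nonneg_left (hg' (left_mem_Icc.2 hab) hb hab) ha]

-- After the last time at which `s g'(s) ≤ g(s)` holds, `g(s) / s` is non-decreasing, so `hstep`
-- makes `g'` non-increasing there; then `s g'(s) - g(s)` is non-increasing as well.
theorem mul_deriv_le_self {g g' : ℝ → ℝ}
    (hg : ∀ s, 0 ≤ s → HasDerivWithinAt g (g' s) (Ici 0) s) (hg' : ContinuousOn g' (Ici 0))
    (hpos : ∀ s, 0 ≤ s → 0 ≤ g s)
    (hstep : ∀ a b, 0 < a → a ≤ b → 0 < g' a → b * g a ≤ a * g b → g' b ≤ g' a)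
    {t : ℝ} (ht : 0 ≤ t) : t * g' t ≤ g t := by
  set q : ℝ → ℝ := fun s => s * g' s - g s
  have hgat (s : ℝ) (hs : 0 < s) : HasDerivAt g (g' s) s :=
    (hg s hs.le).hasDerivAt (Ici_mem_nhds hs)
  have hq : ContinuousOn q (Ici 0) :=
    (continuousOn_id.mul hg').sub fun s hs => (hg s hs).continuousWithinAt
  by_contra! hlt
  obtain ⟨c, ⟨hc0, hct⟩, hqc, hqpos⟩ := exists_nonpos_forall_Ioc_pos
    (hq.mono Icc_subset_Ici_self) ht (by simpa [q] using hpos 0 le_rfl) (sub_pos.2 hlt)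
  have hanti : AntitoneOn g' (Ioc c t) := by
    intro a ha b hb hab
    have ha0 : 0 < a := hc0.trans_lt ha.1
    have hgrow : a * -g b ≤ b * -g a := by
      refine mul_le_mul_of_mul_deriv_le (f := fun s => -g s) (f' := fun s => -g' s) ha0 hab
        (fun s hs => (hgat s hs).neg) fun s hs => ?_
      linarith [hqpos s ⟨ha.1.trans hs.1, hs.2.le.trans hb.2⟩]
    refine hstep a b ha0 hab (pos_of_mul_pos_right ?_ ha0.le) (by linarith)
    linarith [hqpos a ha, hpos a ha0.le]
  have hqt : ∀ a ∈ Ioo c t, q t ≤ q a := fun a ha =>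
    mul_deriv_sub_le_of_antitoneOn_deriv (hc0.trans ha.1.le) ha.2.le
      (fun s hs => hgat s (hc0.trans_lt (ha.1.trans_le hs.1)))
      (hanti.mono fun s hs => ⟨ha.1.trans_le hs.1, hs.2⟩)
  have hlim : Tendsto q (𝓝[>] c) (𝓝 (q c)) := (hq c hc0).mono fun s hs => hc0.trans (le_of_lt hs)
  have hqtc : q t ≤ q c := ge_of_tendsto hlim (eventually_of_mem (Ioo_mem_nhdsGT hct) hqt)
  exact (hqtc.trans hqc).not_gt (sub_pos.2 hlt)

theorem sign_mul_sub_of_monotoneOn {f : ℝ → ℝ} {s : Set ℝ} (hf : MonotoneOn f s) {a b : ℝ}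
    (ha : a ∈ s) (hb : b ∈ s) : SignType.sign (a - b) * (f a - f b) = |f a - f b| := by
  rcases lt_trichotomy a b with h | rfl | h
  · simp [sign_neg (sub_neg.2 h), abs_of_nonpos (sub_nonpos.2 (hf ha hb h.le))]
  · simp
  · simp [sign_pos (sub_pos.2 h), abs_of_nonneg (sub_nonneg.2 (hf hb ha h.le))]

theorem abs_div_sub_div_mul_le {l a b : ℝ} (hl : 0 < l) (ha : l ≤ a) (hb : 0 < b) :
    |l / a - l / b| * b ≤ |a - b| := by
  have ha0 := hl.trans_le ha
  calc |l / a - l / b| * b = |(l / a - l / b) * b| := by rw [abs_mul, abs_of_pos hb]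
    _ = |l / a * (b - a)| := by congr 1; field_simp
    _ = l / a * |a - b| := by rw [abs_mul, abs_of_pos (div_pos hl ha0), abs_sub_comm]
    _ ≤ |a - b| := mul_le_of_le_one_left (abs_nonneg _) ((div_le_one ha0).2 ha)

theorem abs_div_sub_div_le {l a b : ℝ} (hl : 0 < l) (ha : l ≤ a) (hb : l ≤ b) :
    |l / a - l / b| ≤ |a - b| / l := by
  rw [le_div_iff₀ hl]
  exact (mul_le_mul_of_nonneg_left hb (abs_nonneg _)).trans
    (abs_div_sub_div_mul_le hl ha (hl.trans_le hb))

end Calculus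

section Velocity

variable {v : ℝ → ℝ} {L : ℝ≥0}

theorem mul_sub_le_map_sub (hlip : LipschitzOnWith L v (Icc 0 1)) {c : ℝ}
    (hd : ∀ᵐ r ∂volume.restrict (Icc (0 : ℝ) 1), deriv v r ≤ c) {r s : ℝ} (hr : 0 ≤ r)
    (hrs : r ≤ s) (hs : s ≤ 1) : -c * (s - r) ≤ v r - v s := by
  have hsub : Icc r s ⊆ Icc 0 1 := Icc_subset_Icc hr hs
  have := sub_le_mul_of_ae_deriv_le (hlip.mono hsub) hrs
    (ae_restrict_of_ae_restrict_of_subset (Ioo_subset_Icc_self.trans hsub) hd)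
  linarith

theorem VelocityAssumption.antitoneOn (hv : VelocityAssumption v L) : AntitoneOn v (Icc 0 1) := by
  obtain ⟨c, hc, hd⟩ := hv.deriv_le
  intro r hr s hs hrs
  have := mul_sub_le_map_sub hv.lipschitz hd hr.1 hrs hs.2
  nlinarith [mul_nonneg (neg_nonneg.2 hc.le) (sub_nonneg.2 hrs)]

theorem antitoneOn_sub_comp_mul (hlip : LipschitzOnWith L v (Icc 0 1))
    (hm : VelocityMonotonicity v) {a : ℝ} (ha : 0 < a) (ha1 : a ≤ 1) :
    AntitoneOn (fun r => v r - v (a * r)) (Icc 0 1) := by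
  have hmaps : MapsTo (a * ·) (Icc (0 : ℝ) 1) (Icc 0 1) := fun r hr =>
    ⟨mul_nonneg ha.le hr.1, mul_le_one₀ ha1 hr.1 hr.2⟩
  have hmul : LipschitzOnWith ‖a‖₊ (a * ·) (Icc (0 : ℝ) 1) := (lipschitzWith_smul a).lipschitzOnWith
  have hdiff : ∀ᵐ r, r ∈ Ioo (0 : ℝ) 1 → DifferentiableAt ℝ v r := by
    filter_upwards [hlip.ae_differentiableWithinAt_of_mem_real] with r hr hr01
    exact (hr (Ioo_subset_Icc_self hr01)).differentiableAt (Icc_mem_nhds hr01.1 hr01.2)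
  intro r hr s hs hrs
  have hsub : Icc r s ⊆ Icc 0 1 := Icc_subset_Icc hr.1 hs.2
  have hlip' := (hlip.sub (hlip.comp hmul hmaps)).mono hsub
  suffices ∀ᵐ p ∂volume.restrict (Ioo r s), deriv (fun p => v p - (v ∘ (a * ·)) p) p ≤ 0 by
    simpa using sub_le_mul_of_ae_deriv_le hlip' hrs this
  rw [ae_restrict_iff' measurableSet_Ioo]
  filter_upwards [hdiff, ae_comp_mul_left hdiff ha.ne'] with p hp hap hpm
  have hp01 : p ∈ Ioo (0 : ℝ) 1 := ⟨hr.1.trans_lt hpm.1, hpm.2.trans_le hs.2⟩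
  have hapm : a * p ≤ p := mul_le_of_le_one_left hp01.1.le ha1
  have hap01 : a * p ∈ Ioo (0 : ℝ) 1 := ⟨mul_pos ha hp01.1, hapm.trans_lt hp01.2⟩
  have hderiv : HasDerivAt (fun p => v p - (v ∘ (a * ·)) p) (deriv v p - deriv v (a * p) * a) p :=
    (hp hp01).hasDerivAt.sub ((hap hap01).hasDerivAt.comp p (hasDerivAt_const_mul a))
  have hmono : p * deriv v p ≤ a * p * deriv v (a * p) :=
    hm ⟨hap01, hap hap01⟩ ⟨hp01, hp hp01⟩ hapm
  rw [hderiv.deriv]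
  refine nonpos_of_mul_nonpos_right (a := p) ?_ hp01.1
  linarith

end Velocity

section DiscreteVariation

/-- The total variation of a finite sequence. -/
noncomputable def discreteVariation {n : ℕ} (y : Fin (n + 1) → ℝ) : ℝ :=
  ∑ j : Fin n, |y j.succ - y j.castSucc|

theorem sum_succ_sub_castSucc {n : ℕ} (y : Fin (n + 1) → ℝ) :
    ∑ j : Fin n, (y j.succ - y j.castSucc) = y (Fin.last n) - y 0 := by
  rw [Finset.sum_sub_distrib, sub_eq_sub_iff_add_eq_add, add_comm, ← Fin.sum_univ_succ,
    Fin.sum_univ_castSucc, add_comm]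

theorem discreteVariation_cons {n : ℕ} (a : ℝ) (y : Fin (n + 1) → ℝ) :
    discreteVariation (Fin.cons a y : Fin (n + 2) → ℝ) = |y 0 - a| + discreteVariation y := by
  simp [discreteVariation, Fin.sum_univ_succ]

theorem abs_le_abs_last_add_discreteVariation {n : ℕ} (y : Fin (n + 1) → ℝ) (i : Fin (n + 1)) :
    |y i| ≤ |y (Fin.last n)| + discreteVariation y := by
  induction n with
  | zero => simp [discreteVariation, Fin.fin_one_eq_zero i]
  | succ n ih =>
    cases y using Fin.consCases with | _ a y
    rw [discreteVariation_cons, ← Fin.succ_last, Fin.cons_succ]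
    cases i using Fin.cases with
    | zero =>
      rw [Fin.cons_zero]
      linarith [ih y 0, abs_sub_abs_le_abs_sub a (y 0), abs_sub_comm a (y 0)]
    | succ i =>
      rw [Fin.cons_succ]
      linarith [ih y i, abs_nonneg (y 0 - a)]

theorem discreteVariation_le_of_sub_le {n : ℕ} {y : Fin (n + 1) → ℝ} {b : Fin n → ℝ}
    (hb : ∀ j, 0 ≤ b j) (h : ∀ j, y j.succ - y j.castSucc ≤ b j) :
    discreteVariation y ≤ 2 * ∑ j, b j - (y (Fin.last n) - y 0) := by
  rw [← sum_succ_sub_castSucc, Finset.mul_sum, ← Finset.sum_sub_distrib]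
  refine Finset.sum_le_sum fun j _ => abs_le.2 ⟨?_, ?_⟩ <;> linarith [hb j, h j]

theorem discreteVariation_le_initial {n : ℕ} {y y' : ℝ → Fin (n + 1) → ℝ}
    (hy : ∀ s, 0 ≤ s → HasDerivWithinAt y (y' s) (Ici 0) s)
    (hlast : ∀ s, 0 ≤ s → y' s (Fin.last n) = 0)
    (hsign : ∀ s, 0 ≤ s → ∀ j : Fin n, SignType.sign (y s j.succ - y s j.castSucc) *
      y' s j.castSucc = |y' s j.castSucc|) {t : ℝ} (ht : 0 ≤ t) :
    discreteVariation (y t) ≤ discreteVariation (y 0) := by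
  have hderiv (s : ℝ) (hs : 0 ≤ s) :
      HasDerivWithinAt (fun s (j : Fin n) => y s j.succ - y s j.castSucc)
        (fun j => y' s j.succ - y' s j.castSucc) (Ici 0) s := by
    have := hasDerivWithinAt_pi.1 (hy s hs)
    exact hasDerivWithinAt_pi.2 fun j => (this j.succ).sub (this j.castSucc)
  have hrate (s : ℝ) (hs : 0 ≤ s) : ∑ j : Fin n, rightDerivAbs (y s j.succ - y s j.castSucc)
      (y' s j.succ - y' s j.castSucc) ≤ 0 :=
    calc _ ≤ ∑ j : Fin n, (|y' s j.succ| - |y' s j.castSucc|) :=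
          Finset.sum_le_sum fun j _ => rightDerivAbs_sub_le (hsign s hs j)
      _ = -|y' s 0| := by rw [sum_succ_sub_castSucc (|y' s ·|), hlast s hs, abs_zero, zero_sub]
      _ ≤ 0 := neg_nonpos.2 (abs_nonneg _)
  simpa only [discreteVariation, zero_mul, add_zero] using sum_abs_le_add_mul hderiv hrate ht

end DiscreteVariation

section Densities

variable {N : ℕ} (x : Fin (N + 1) → ℝ → ℝ) (t : ℝ)

/-- The distance from vehicle `j` to the preceding one. -/
def gap (j : Fin N) (t : ℝ) : ℝ := x j.succ t - x j.castSucc t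

/-- The discrete density ahead of each vehicle, which is `0` for the leader. -/
noncomputable def vehicleDensity : Fin (N + 1) → ℝ :=
  Fin.snoc (fun j => discreteDensity x j t) 0

/-- The values of the Eulerian discrete density from left to right: the densities of the vehicles,
preceded by the value `0` on the left of all vehicles. -/
noncomputable def extendedDensity : Fin (N + 2) → ℝ := Fin.cons 0 (vehicleDensity x t)

/-- The time derivative of `vehicleDensity` along a solution with velocity `v`. -/
noncomputable def vehicleDensityRate (v : ℝ → ℝ) : Fin (N + 1) → ℝ :=
  Fin.snoc (fun j => 1 / (N : ℝ) / gap x j t ^ 2 *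
    (v (vehicleDensity x t j.castSucc) - v (vehicleDensity x t j.succ))) 0

@[simp] theorem vehicleDensity_castSucc (j : Fin N) :
    vehicleDensity x t j.castSucc = 1 / (N : ℝ) / gap x j t := by
  simp only [vehicleDensity, Fin.snoc_castSucc, discreteDensity, gap]

@[simp] theorem vehicleDensity_last : vehicleDensity x t (Fin.last N) = 0 :=
  Fin.snoc_last _ _

theorem discreteVariation_sub (z : Fin (N + 1) → ℝ → ℝ) :
    discreteVariation (fun i => x i t - z i t) = ∑ j, |gap x j t - gap z j t| := by
  simp only [discreteVariation, gap, sub_sub_sub_comm]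

end Densities

namespace IsFtLSolution

variable {v : ℝ → ℝ} {L : ℝ≥0} {N : ℕ} {x z : Fin (N + 1) → ℝ → ℝ} {t : ℝ}

theorem le_gap (hx : IsFtLSolution v N x) (hv : AntitoneOn v (Icc 0 1)) (hN : 1 ≤ N) (j : Fin N)
    (ht : 0 ≤ t) : 1 / (N : ℝ) ≤ gap x j t := by
  have hl : 0 < 1 / (N : ℝ) := by positivity
  let density (i : Fin (N + 1)) (s : ℝ) : Icc (0 : ℝ) 1 :=
    projIcc 0 1 zero_le_one (vehicleDensity x s i)
  have hderiv (i : Fin (N + 1)) (s : ℝ) (hs : 0 ≤ s) :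
      HasDerivWithinAt (x i) (v (density i s)) (Ici 0) s := by
    cases i using Fin.lastCases with
    | last => simpa [density] using hx.leader s hs
    | cast j => simpa [density, discreteDensity, gap] using hx.follower j s hs
  refine le_of_deriv_nonneg_below hl
    (fun s hs => (hderiv j.succ s hs).sub (hderiv j.castSucc s hs)) (fun s _ hgap => ?_)
    (hx.initial_gap j) ht
  -- A vehicle closer than `1 / N` to the preceding one moves at the minimal speed `v 1`.
  have hfull : density j.castSucc s = 1 := by
    refine projIcc_of_right_le _ ?_
    rw [vehicleDensity_castSucc]
    exact (one_le_div hgap.1).2 hgap.2.le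
  rw [hfull, sub_nonneg]
  exact hv (density j.succ s).2 (right_mem_Icc.2 zero_le_one) (density j.succ s).2.2

theorem gap_pos (hx : IsFtLSolution v N x) (hv : AntitoneOn v (Icc 0 1)) (hN : 1 ≤ N) (j : Fin N)
    (ht : 0 ≤ t) : 0 < gap x j t :=
  (by positivity : 0 < 1 / (N : ℝ)).trans_le (hx.le_gap hv hN j ht)

theorem strictMono (hx : IsFtLSolution v N x) (hv : AntitoneOn v (Icc 0 1)) (hN : 1 ≤ N)
    (ht : 0 ≤ t) : StrictMono (x · t) :=
  Fin.strictMono_iff_lt_succ.2 fun j => sub_pos.1 (hx.gap_pos hv hN j ht)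

theorem vehicleDensity_mem_Icc (hx : IsFtLSolution v N x) (hv : AntitoneOn v (Icc 0 1))
    (hN : 1 ≤ N) (i : Fin (N + 1)) (ht : 0 ≤ t) : vehicleDensity x t i ∈ Icc (0 : ℝ) 1 := by
  cases i using Fin.lastCases with
  | last => simp
  | cast j =>
    have hgap := hx.gap_pos hv hN j ht
    rw [vehicleDensity_castSucc]
    exact ⟨by positivity, (div_le_one hgap).2 (hx.le_gap hv hN j ht)⟩

theorem hasDerivWithinAt (hx : IsFtLSolution v N x) (hv : AntitoneOn v (Icc 0 1)) (hN : 1 ≤ N)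
    (i : Fin (N + 1)) (ht : 0 ≤ t) :
    HasDerivWithinAt (x i) (v (vehicleDensity x t i)) (Ici 0) t := by
  cases i using Fin.lastCases with
  | last => simpa using hx.leader t ht
  | cast j =>
    have hfollower := hx.follower j t ht
    rwa [show discreteDensity x j t = vehicleDensity x t j.castSucc from
      (vehicleDensity_castSucc x t j).symm,
      projIcc_of_mem _ (hx.vehicleDensity_mem_Icc hv hN j.castSucc ht)] at hfollower

theorem hasDerivWithinAt_gap (hx : IsFtLSolution v N x) (hv : AntitoneOn v (Icc 0 1))
    (hN : 1 ≤ N) (j : Fin N) (ht : 0 ≤ t) :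
    HasDerivWithinAt (gap x j)
      (v (vehicleDensity x t j.succ) - v (vehicleDensity x t j.castSucc)) (Ici 0) t :=
  (hx.hasDerivWithinAt hv hN j.succ ht).sub (hx.hasDerivWithinAt hv hN j.castSucc ht)

theorem hasDerivWithinAt_vehicleDensity (hx : IsFtLSolution v N x) (hv : AntitoneOn v (Icc 0 1))
    (hN : 1 ≤ N) (ht : 0 ≤ t) :
    HasDerivWithinAt (vehicleDensity x) (vehicleDensityRate x t v) (Ici 0) t := by
  refine hasDerivWithinAt_pi.2 fun i => ?_
  cases i using Fin.lastCases with
  | last => simpa [vehicleDensityRate] using hasDerivWithinAt_const t (Ici 0) (0 : ℝ)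
  | cast j =>
    simp only [vehicleDensityRate, vehicleDensity_castSucc, Fin.snoc_castSucc]
    refine ((hasDerivWithinAt_const t (Ici 0) (1 / (N : ℝ))).fun_div
      (hx.hasDerivWithinAt_gap hv hN j ht) (hx.gap_pos hv hN j ht).ne').congr_deriv ?_
    rw [vehicleDensity_castSucc]
    ring

theorem sum_abs_gap_sub_gap_le (hx : IsFtLSolution v N x) (hz : IsFtLSolution v N z)
    (hv : AntitoneOn v (Icc 0 1)) (hN : 1 ≤ N) (ht : 0 ≤ t) :
    ∑ j, |gap x j t - gap z j t| ≤ initialGapDifference x z := by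
  have hl : 0 < 1 / (N : ℝ) := by positivity
  have hmono : MonotoneOn (fun g => v (1 / (N : ℝ) / g)) (Ici (1 / (N : ℝ))) := by
    refine hv.comp (fun a ha b _ hab => ?_) fun g hg => ?_
    · exact div_le_div_of_nonneg_left hl.le (hl.trans_le ha) hab
    · exact ⟨div_nonneg hl.le (hl.le.trans hg), (div_le_one (hl.trans_le hg)).2 hg⟩
  have hder (s : ℝ) (hs : 0 ≤ s) : HasDerivWithinAt (fun s i => x i s - z i s)
      (fun i => v (vehicleDensity x s i) - v (vehicleDensity z s i)) (Ici 0) s :=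
    hasDerivWithinAt_pi.2 fun i =>
      (hx.hasDerivWithinAt hv hN i hs).sub (hz.hasDerivWithinAt hv hN i hs)
  change _ ≤ ∑ j, |gap x j 0 - gap z j 0|
  rw [← discreteVariation_sub, ← discreteVariation_sub]
  refine discreteVariation_le_initial hder (fun s _ => ?_) (fun s hs j => ?_) ht
  · simp only [vehicleDensity_last, sub_self]
  · rw [sub_sub_sub_comm, vehicleDensity_castSucc, vehicleDensity_castSucc]
    exact sign_mul_sub_of_monotoneOn hmono (hx.le_gap hv hN j hs) (hz.le_gap hv hN j hs)

theorem sum_abs_velocity_sub_le (hx : IsFtLSolution v N x) (hz : IsFtLSolution v N z)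
    (hlip : LipschitzOnWith L v (Icc 0 1)) (hv : AntitoneOn v (Icc 0 1)) (hN : 1 ≤ N)
    (ht : 0 ≤ t) :
    ∑ i, |v (vehicleDensity x t i) - v (vehicleDensity z t i)| ≤
      L * N * initialGapDifference x z := by
  have hstep (j : Fin N) : |v (vehicleDensity x t j.castSucc) - v (vehicleDensity z t j.castSucc)| ≤
      L * N * |gap x j t - gap z j t| :=
    calc _ ≤ L * |vehicleDensity x t j.castSucc - vehicleDensity z t j.castSucc| :=
          hlip.dist_le_mul _ (hx.vehicleDensity_mem_Icc hv hN _ ht) _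
            (hz.vehicleDensity_mem_Icc hv hN _ ht)
      _ ≤ L * (|gap x j t - gap z j t| / (1 / N)) := by
          rw [vehicleDensity_castSucc, vehicleDensity_castSucc]
          gcongr
          exact abs_div_sub_div_le (by positivity) (hx.le_gap hv hN j ht) (hz.le_gap hv hN j ht)
      _ = L * N * |gap x j t - gap z j t| := by rw [div_div_eq_mul_div, div_one]; ring
  rw [Fin.sum_univ_castSucc, vehicleDensity_last, vehicleDensity_last, sub_self, abs_zero, add_zero]
  calc _ ≤ ∑ j, L * N * |gap x j t - gap z j t| := Finset.sum_le_sum fun j _ => hstep j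
    _ = L * N * ∑ j, |gap x j t - gap z j t| := (Finset.mul_sum _ _ _).symm
    _ ≤ _ := by gcongr; exact hx.sum_abs_gap_sub_gap_le hz hv hN ht

theorem sum_abs_sub_sub_initial_le (hx : IsFtLSolution v N x) (hz : IsFtLSolution v N z)
    (hlip : LipschitzOnWith L v (Icc 0 1)) (hv : AntitoneOn v (Icc 0 1)) (hN : 1 ≤ N)
    (ht : 0 ≤ t) :
    ∑ i, |x i t - z i t - (x i 0 - z i 0)| ≤ L * N * initialGapDifference x z * t := by
  have hder (s : ℝ) (hs : 0 ≤ s) : HasDerivWithinAt (fun s i => x i s - z i s - (x i 0 - z i 0))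
      (fun i => v (vehicleDensity x s i) - v (vehicleDensity z s i)) (Ici 0) s :=
    hasDerivWithinAt_pi.2 fun i =>
      ((hx.hasDerivWithinAt hv hN i hs).sub (hz.hasDerivWithinAt hv hN i hs)).sub_const _
  simpa using sum_abs_le_add_mul hder (fun s hs => (Finset.sum_le_sum fun i _ =>
    rightDerivAbs_le_abs _ _).trans (hx.sum_abs_velocity_sub_le hz hlip hv hN hs)) ht

theorem leader_sub_leader (hx : IsFtLSolution v N x) (hz : IsFtLSolution v N z) (ht : 0 ≤ t) :
    x (Fin.last N) t - z (Fin.last N) t = x (Fin.last N) 0 - z (Fin.last N) 0 := by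
  have hder (s : ℝ) (hs : 0 ≤ s) :
      HasDerivWithinAt (fun s => x (Fin.last N) s - z (Fin.last N) s) 0 (Ici 0) s :=
    ((hx.leader s hs).sub (hz.leader s hs)).congr_deriv (sub_self _)
  exact constant_of_has_deriv_right_zero
    (fun s hs => (hder s hs.1).continuousWithinAt.mono Icc_subset_Ici_self)
    (fun s hs => (hder s hs.1).mono (Ici_subset_Ici.2 hs.1)) t (right_mem_Icc.2 ht)

theorem abs_sub_le (hx : IsFtLSolution v N x) (hz : IsFtLSolution v N z)
    (hv : AntitoneOn v (Icc 0 1)) (hN : 1 ≤ N) (hlead : x (Fin.last N) 0 = z (Fin.last N) 0)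
    (i : Fin (N + 1)) (ht : 0 ≤ t) : |x i t - z i t| ≤ initialGapDifference x z := by
  refine (abs_le_abs_last_add_discreteVariation (fun i => x i t - z i t) i).trans ?_
  rw [hx.leader_sub_leader hz ht, hlead, sub_self, abs_zero, zero_add, discreteVariation_sub]
  exact hx.sum_abs_gap_sub_gap_le hz hv hN ht

theorem spread_le (hx : IsFtLSolution v N x) (hv : AntitoneOn v (Icc 0 1)) (hN : 1 ≤ N)
    (ht : 0 ≤ t) : x (Fin.last N) t - x 0 t ≤ x (Fin.last N) 0 - x 0 0 + (v 0 - v 1) * t := by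
  have hder (s : ℝ) (hs : 0 ≤ s) := (hx.leader s hs).sub (hx.hasDerivWithinAt hv hN 0 hs)
  refine le_add_mul_of_right_deriv_le (f := fun t => x (Fin.last N) t - x 0 t)
    (fun s hs => (hder s hs).continuousWithinAt)
    (fun s hs => (hder s hs).mono (Ici_subset_Ici.2 hs)) (fun s hs => ?_) ht
  have hmem := hx.vehicleDensity_mem_Icc hv hN 0 hs
  exact sub_le_sub_left (hv hmem (right_mem_Icc.2 zero_le_one) hmem.2) _

theorem discreteVariation_extendedDensity_le_initial (hx : IsFtLSolution v N x)
    (hv : AntitoneOn v (Icc 0 1)) (hN : 1 ≤ N) (ht : 0 ≤ t) :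
    discreteVariation (extendedDensity x t) ≤ discreteVariation (extendedDensity x 0) := by
  refine discreteVariation_le_initial (y' := fun s => Fin.cons 0 (vehicleDensityRate x s v))
    (fun s hs => hasDerivWithinAt_pi.2 fun i => ?_) (fun s _ => ?_) (fun s hs i => ?_) ht
  · cases i using Fin.cases with
    | zero => exact hasDerivWithinAt_const s (Ici 0) (0 : ℝ)
    | succ i => exact hasDerivWithinAt_pi.1 (hx.hasDerivWithinAt_vehicleDensity hv hN hs) i
  · rw [← Fin.succ_last, Fin.cons_succ, vehicleDensityRate, Fin.snoc_last]
  · cases i using Fin.cases with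
    | zero => simp
    | succ j =>
      have hrate : 0 < 1 / (N : ℝ) / gap x j s ^ 2 := by
        have := hx.gap_pos hv hN j hs
        positivity
      have hsign := sign_mul_sub_of_monotoneOn hv.neg (hx.vehicleDensity_mem_Icc hv hN j.succ hs)
        (hx.vehicleDensity_mem_Icc hv hN j.castSucc hs)
      rw [neg_sub_neg] at hsign
      rw [← Fin.succ_castSucc, Fin.cons_succ, extendedDensity, Fin.cons_succ, Fin.cons_succ,
        vehicleDensityRate, Fin.snoc_castSucc, mul_left_comm, hsign, abs_mul,
        abs_of_pos hrate]

theorem mul_velocity_sub_le_gap_of_successor (hx : IsFtLSolution v N x)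
    (hv : AntitoneOn v (Icc 0 1)) (hcont : ContinuousOn v (Icc 0 1))
    (hm : ∀ a : ℝ, 0 < a → a ≤ 1 → AntitoneOn (fun r => v r - v (a * r)) (Icc 0 1)) (hN : 1 ≤ N)
    {j : Fin N} (hj : ∀ a b : ℝ, 0 < a → a ≤ b →
      a * vehicleDensity x a j.succ ≤ b * vehicleDensity x b j.succ) (ht : 0 ≤ t) :
    t * (v (vehicleDensity x t j.succ) - v (vehicleDensity x t j.castSucc)) ≤ gap x j t := by
  have hmem (i : Fin (N + 1)) (s : ℝ) (hs : 0 ≤ s) := hx.vehicleDensity_mem_Icc hv hN i hs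
  have hspeed (i : Fin (N + 1)) : ContinuousOn (fun s => v (vehicleDensity x s i)) (Ici 0) :=
    hcont.comp (fun s hs => (hasDerivWithinAt_pi.1
      (hx.hasDerivWithinAt_vehicleDensity hv hN hs) i).continuousWithinAt) (hmem i)
  refine mul_deriv_le_self (fun s hs => hx.hasDerivWithinAt_gap hv hN j hs)
    ((hspeed _).sub (hspeed _)) (fun s hs => (hx.gap_pos hv hN j hs).le)
    (fun a b ha hab hlt hgrow => ?_) ht
  have hb := ha.trans_le hab
  have hr : 0 < a / b := div_pos ha hb
  have hr1 : a / b ≤ 1 := (div_le_one hb).2 hab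
  have hmul (i : Fin (N + 1)) : a / b * vehicleDensity x a i ∈ Icc (0 : ℝ) 1 :=
    ⟨mul_nonneg hr.le (hmem i a ha.le).1, mul_le_one₀ hr1 (hmem i a ha.le).1 (hmem i a ha.le).2⟩
  have hsucc : a / b * vehicleDensity x a j.succ ≤ vehicleDensity x b j.succ := by
    rw [div_mul_eq_mul_div, div_le_iff₀ hb, mul_comm (vehicleDensity x b j.succ)]
    exact hj a b ha hab
  have hcast : vehicleDensity x b j.castSucc ≤ a / b * vehicleDensity x a j.castSucc := by
    have hga := hx.gap_pos hv hN j ha.le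
    have hgb := hx.gap_pos hv hN j hb.le
    rw [vehicleDensity_castSucc, vehicleDensity_castSucc, div_mul_div_comm,
      div_le_div_iff₀ hgb (mul_pos hb hga), mul_assoc, mul_left_comm a]
    exact mul_le_mul_of_nonneg_left hgrow (by positivity)
  have hle : vehicleDensity x a j.succ ≤ vehicleDensity x a j.castSucc := by
    by_contra! hgt
    exact (sub_pos.1 hlt).not_ge (hv (hmem _ a ha.le) (hmem _ a ha.le) hgt.le)
  have h₁ := hv (hmul _) (hmem _ b hb.le) hsucc
  have h₂ := hv (hmem _ b hb.le) (hmul _) hcast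
  have h₃ := hm (a / b) hr hr1 (hmem _ a ha.le) (hmem _ a ha.le) hle
  dsimp only at h₃
  linarith

theorem mul_vehicleDensity_le_mul_vehicleDensity (hx : IsFtLSolution v N x)
    (hv : AntitoneOn v (Icc 0 1)) (hcont : ContinuousOn v (Icc 0 1))
    (hm : ∀ a : ℝ, 0 < a → a ≤ 1 → AntitoneOn (fun r => v r - v (a * r)) (Icc 0 1)) (hN : 1 ≤ N)
    (i : Fin (N + 1)) {a b : ℝ} (ha : 0 < a) (hab : a ≤ b) :
    a * vehicleDensity x a i ≤ b * vehicleDensity x b i := by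
  induction i using Fin.reverseInduction generalizing a b with
  | last => simp only [vehicleDensity_last, mul_zero, le_refl]
  | cast j ih =>
    have hgap := mul_le_mul_of_mul_deriv_le ha hab
      (fun s hs => (hx.hasDerivWithinAt_gap hv hN j hs.le).hasDerivAt (Ici_mem_nhds hs))
      fun s hs => hx.mul_velocity_sub_le_gap_of_successor hv hcont hm hN
        (fun a b ha hab => ih ha hab) (ha.trans hs.1).le
    have hga := hx.gap_pos hv hN j ha.le
    have hgb := hx.gap_pos hv hN j (ha.le.trans hab)
    rw [vehicleDensity_castSucc, vehicleDensity_castSucc, mul_div_left_comm, mul_div_left_comm b]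
    refine mul_le_mul_of_nonneg_left ?_ (by positivity)
    rwa [div_le_div_iff₀ hga hgb]

theorem mul_velocity_sub_le_gap (hx : IsFtLSolution v N x) (hv : AntitoneOn v (Icc 0 1))
    (hcont : ContinuousOn v (Icc 0 1))
    (hm : ∀ a : ℝ, 0 < a → a ≤ 1 → AntitoneOn (fun r => v r - v (a * r)) (Icc 0 1)) (hN : 1 ≤ N)
    (j : Fin N) (ht : 0 ≤ t) :
    t * (v (vehicleDensity x t j.succ) - v (vehicleDensity x t j.castSucc)) ≤ gap x j t :=
  hx.mul_velocity_sub_le_gap_of_successor hv hcont hm hN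
    (fun _ _ => hx.mul_vehicleDensity_le_mul_vehicleDensity hv hcont hm hN j.succ) ht

theorem discreteVariation_velocity_le (hx : IsFtLSolution v N x) (hv : AntitoneOn v (Icc 0 1))
    (hcont : ContinuousOn v (Icc 0 1))
    (hm : ∀ a : ℝ, 0 < a → a ≤ 1 → AntitoneOn (fun r => v r - v (a * r)) (Icc 0 1)) (hN : 1 ≤ N)
    (ht : 0 < t) :
    discreteVariation (fun i => v (vehicleDensity x t i)) ≤
      2 * ((x (Fin.last N) 0 - x 0 0) / t + (v 0 - v 1)) := by
  have hgap (j : Fin N) : 0 ≤ gap x j t / t := div_nonneg (hx.gap_pos hv hN j ht.le).le ht.le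
  have hmem := hx.vehicleDensity_mem_Icc hv hN 0 ht.le
  have hstep (j : Fin N) :
      v (vehicleDensity x t j.succ) - v (vehicleDensity x t j.castSucc) ≤ gap x j t / t := by
    rw [le_div_iff₀ ht, mul_comm]
    exact hx.mul_velocity_sub_le_gap hv hcont hm hN j ht.le
  have hspread : ∑ j, gap x j t / t ≤ (x (Fin.last N) 0 - x 0 0) / t + (v 0 - v 1) := by
    rw [← Finset.sum_div, div_add' _ _ _ ht.ne']
    gcongr
    exact (sum_succ_sub_castSucc (x · t)).trans_le (hx.spread_le hv hN ht.le)
  have hleader : v (vehicleDensity x t 0) ≤ v (vehicleDensity x t (Fin.last N)) := by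
    rw [vehicleDensity_last]
    exact hv (left_mem_Icc.2 zero_le_one) hmem hmem.1
  linarith [discreteVariation_le_of_sub_le (y := fun i => v (vehicleDensity x t i)) hgap hstep]

theorem discreteVariation_extendedDensity_le (hx : IsFtLSolution v N x)
    (hv : AntitoneOn v (Icc 0 1)) (hcont : ContinuousOn v (Icc 0 1))
    (hm : ∀ a : ℝ, 0 < a → a ≤ 1 → AntitoneOn (fun r => v r - v (a * r)) (Icc 0 1)) (hN : 1 ≤ N)
    {c : ℝ} (hc : 0 < c)
    (hvc : ∀ r s : ℝ, 0 ≤ r → r ≤ s → s ≤ 1 → c * (s - r) ≤ v r - v s) (ht : 0 < t) :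
    discreteVariation (extendedDensity x t) ≤
      1 + 2 / c * ((x (Fin.last N) 0 - x 0 0) / t + (v 0 - v 1)) := by
  have hmem (i : Fin (N + 1)) := hx.vehicleDensity_mem_Icc hv hN i ht.le
  have hexpand {r s : ℝ} (hr : r ∈ Icc (0 : ℝ) 1) (hs : s ∈ Icc (0 : ℝ) 1) :
      c * |r - s| ≤ |v r - v s| := by
    rcases le_total r s with h | h
    · rw [abs_sub_comm, abs_of_nonneg (sub_nonneg.2 h)]
      exact (hvc r s hr.1 h hs.2).trans (le_abs_self _)
    · rw [abs_of_nonneg (sub_nonneg.2 h), abs_sub_comm]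
      exact (hvc s r hs.1 h hr.2).trans (le_abs_self _)
  have hdensity : c * discreteVariation (vehicleDensity x t) ≤
      discreteVariation (fun i => v (vehicleDensity x t i)) := by
    rw [discreteVariation, Finset.mul_sum]
    exact Finset.sum_le_sum fun j _ => hexpand (hmem j.succ) (hmem j.castSucc)
  rw [extendedDensity, discreteVariation_cons, sub_zero, abs_of_nonneg (hmem 0).1]
  gcongr
  · exact (hmem 0).2
  · rw [div_mul_eq_mul_div, le_div_iff₀' hc]
    exact hdensity.trans (hx.discreteVariation_velocity_le hv hcont hm hN ht)

end IsFtLSolution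

section Wasserstein

variable {Ω : Type*} [MeasurableSpace Ω] {ν : Measure Ω} [IsFiniteMeasure ν]

theorem enorm_measureReal_sub_of_subset {s t : Set Ω} (hs : MeasurableSet s) (hst : s ⊆ t) :
    ‖ν.real t - ν.real s‖ₑ = ν (t \ s) := by
  rw [← measureReal_sdiff hst hs, Real.enorm_eq_ofReal measureReal_nonneg, ofReal_measureReal]

theorem enorm_measureReal_sub_of_subset_or_subset {s t : Set Ω} (hs : MeasurableSet s)
    (ht : MeasurableSet t) (hst : s ⊆ t ∨ t ⊆ s) :
    ‖ν.real s - ν.real t‖ₑ = ν (symmDiff s t) := by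
  rcases hst with h | h
  · rw [← enorm_neg, neg_sub, enorm_measureReal_sub_of_subset hs h, symmDiff_of_le h]
  · rw [enorm_measureReal_sub_of_subset ht h, symmDiff_of_ge h]

theorem Iic_preimage_subset_or_subset {ι : Type*} {a b : ι → ℝ} (h : Monovary a b) (y : ℝ) :
    a ⁻¹' Iic y ⊆ b ⁻¹' Iic y ∨ b ⁻¹' Iic y ⊆ a ⁻¹' Iic y := by
  by_contra! hcon
  obtain ⟨i, hai, hbi⟩ := not_subset.1 hcon.1
  obtain ⟨j, hbj, haj⟩ := not_subset.1 hcon.2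
  rw [mem_preimage, mem_Iic] at hai hbj
  rw [mem_preimage, mem_Iic, not_le] at hbi haj
  exact (hai.trans_lt haj).not_ge (h (hbj.trans_lt hbi))

theorem wassersteinOne_map_map {a b : Ω → ℝ} (ha : Measurable a) (hb : Measurable b)
    (h : Monovary a b) : wassersteinOne (ν.map a) (ν.map b) = ∫⁻ ω, ‖a ω - b ω‖ₑ ∂ν := by
  let between : Set (ℝ × Ω) := {q | min (a q.2) (b q.2) ≤ q.1 ∧ q.1 < max (a q.2) (b q.2)}
  have hbetween : MeasurableSet between :=
    (measurableSet_le (by fun_prop) measurable_fst).inter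
      (measurableSet_lt measurable_fst (by fun_prop))
  have hcumulative (y : ℝ) : ‖cumulative (ν.map a) y - cumulative (ν.map b) y‖ₑ =
      ν (Prod.mk y ⁻¹' between) := by
    rw [cumulative, cumulative, map_measureReal_apply ha measurableSet_Iic,
      map_measureReal_apply hb measurableSet_Iic, enorm_measureReal_sub_of_subset_or_subset
        (ha measurableSet_Iic) (hb measurableSet_Iic) (Iic_preimage_subset_or_subset h y)]
    congr 1
    ext ω
    simp only [mem_symmDiff, mem_preimage, mem_Iic, between, mem_ofPred_eq, min_le_iff, lt_max_iff]
    grind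
  have hdistance (ω : Ω) : volume ((fun y => (y, ω)) ⁻¹' between) = ‖a ω - b ω‖ₑ := by
    change volume (Ico (min (a ω) (b ω)) (max (a ω) (b ω))) = _
    rw [Real.volume_Ico, max_sub_min_eq_abs, abs_sub_comm, Real.enorm_eq_ofReal_abs]
  rw [wassersteinOne, eLpNorm_one_eq_lintegral_enorm]
  simp only [hcumulative, ← hdistance]
  rw [← Measure.prod_apply hbetween, Measure.prod_apply_symm hbetween]

end Wasserstein

section Labels

variable {N : ℕ} {x z : Fin (N + 1) → ℝ → ℝ} {t : ℝ}

/-- The uniform probability measure on the labels `(j, θ)` of the points between vehicle `j` and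
the preceding one. -/
noncomputable def labelMeasure (N : ℕ) : Measure (Fin N × unitInterval) :=
  ENNReal.ofReal (1 / N) • (Measure.count.prod volume)

instance (N : ℕ) : IsFiniteMeasure (labelMeasure N) :=
  Measure.smul_finite _ ENNReal.ofReal_ne_top

/-- The position of the label `(j, θ)`, interpolating linearly between vehicle `j` and the
preceding one. -/
def labelPosition (x : Fin (N + 1) → ℝ → ℝ) (t : ℝ) (q : Fin N × unitInterval) : ℝ :=
  x q.1.castSucc t + q.2 * gap x q.1 t

theorem measurable_labelPosition (x : Fin (N + 1) → ℝ → ℝ) (t : ℝ) :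
    Measurable (labelPosition x t) := by
  refine measurable_from_prod_countable_right fun j => ?_
  unfold labelPosition
  fun_prop

theorem monotone_labelPosition (hx : Monotone (x · t)) :
    Monotone fun q : Fin N ×ₗ unitInterval => labelPosition x t (ofLex q) := by
  have hgap (j : Fin N) : 0 ≤ gap x j t := sub_nonneg.2 (hx j.castSucc_le_succ)
  intro p q hpq
  simp only [labelPosition]
  rcases Prod.Lex.le_iff.1 hpq with hlt | ⟨heq, hle⟩
  · calc _ ≤ x (ofLex p).1.castSucc t + gap x (ofLex p).1 t :=
          add_le_add_right (mul_le_of_le_one_left (hgap _) (ofLex p).2.2.2) _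
      _ = x (ofLex p).1.succ t := add_sub_cancel _ _
      _ ≤ x (ofLex q).1.castSucc t := hx (Fin.succ_le_castSucc_iff.2 hlt)
      _ ≤ _ := le_add_of_nonneg_right (mul_nonneg (ofLex q).2.2.1 (hgap _))
  · rw [heq]
    exact add_le_add_right (mul_le_mul_of_nonneg_right (Subtype.coe_le_coe.2 hle) (hgap _)) _

theorem monovary_labelPosition (hx : Monotone (x · t)) (hz : Monotone (z · t)) :
    Monovary (labelPosition x t) (labelPosition z t) :=
  ((monotone_labelPosition hx).monovary (monotone_labelPosition hz)).comp_right toLex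

theorem volume_preimage_add_mul_unitInterval (a : ℝ) {g : ℝ} (hg : 0 < g) {s : Set ℝ}
    (hs : MeasurableSet s) : volume ((fun θ : unitInterval => a + θ * g) ⁻¹' s) =
      ENNReal.ofReal g⁻¹ * volume (Ico a (a + g) ∩ s) := by
  have hpreimage : (fun θ : ℝ => a + θ * g) ⁻¹' s ∩ Icc 0 1 =
      (fun θ => g * θ) ⁻¹' ((fun y => a + y) ⁻¹' (Icc a (a + g) ∩ s)) := by
    ext θ
    simp only [mem_inter_iff, mem_preimage, mem_Icc, le_add_iff_nonneg_right,
      add_le_add_iff_left, mul_comm g, mul_nonneg_iff_of_pos_right hg, mul_le_iff_le_one_left hg,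
      and_comm]
  have hmeas : MeasurableSet ((fun θ : ℝ => a + θ * g) ⁻¹' s) :=
    (by fun_prop : Measurable fun θ : ℝ => a + θ * g) hs
  calc _ = volume ((fun θ : ℝ => a + θ * g) ⁻¹' s ∩ Icc 0 1) := by
        rw [← Measure.restrict_apply hmeas]
        exact unitInterval.measurePreserving_coe.measure_preimage hmeas.nullMeasurableSet
    _ = ENNReal.ofReal g⁻¹ * volume (Icc a (a + g) ∩ s) := by
        rw [hpreimage, Real.volume_preimage_mul_left hg.ne', measure_preimage_add,
          abs_of_pos (inv_pos.2 hg)]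
    _ = _ := by rw [measure_congr (Ico_ae_eq_Icc.inter (ae_eq_refl s))]

theorem labelMeasure_map_labelPosition_apply (hx : StrictMono (x · t)) {s : Set ℝ}
    (hs : MeasurableSet s) : (labelMeasure N).map (labelPosition x t) s =
      ∑ j : Fin N, ENNReal.ofReal (discreteDensity x j t) *
        volume (Ico (x j.castSucc t) (x j.succ t) ∩ s) := by
  have hpre := measurable_labelPosition x t hs
  rw [Measure.map_apply (measurable_labelPosition x t) hs, labelMeasure, Measure.smul_apply,
    Measure.prod_apply hpre, lintegral_count, tsum_fintype, smul_eq_mul, Finset.mul_sum]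
  refine Finset.sum_congr rfl fun j _ => ?_
  have hgap : 0 < gap x j t := sub_pos.2 (hx j.castSucc_lt_succ)
  refine (congrArg _ (volume_preimage_add_mul_unitInterval (x j.castSucc t) hgap hs)).trans ?_
  rw [← mul_assoc, ← ENNReal.ofReal_mul (by positivity), gap, add_sub_cancel, ← div_eq_mul_inv,
    discreteDensity]

theorem eulerianMeasure_eq_map (hx : StrictMono (x · t)) :
    eulerianMeasure x t = (labelMeasure N).map (labelPosition x t) := by
  have hdensity (y : ℝ) : ENNReal.ofReal (eulerianDensity x t y) =
      ∑ j : Fin N, (Ico (x j.castSucc t) (x j.succ t)).indicator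
        (fun _ => ENNReal.ofReal (discreteDensity x j t)) y := by
    have hnonneg (j : Fin N) : 0 ≤ discreteDensity x j t :=
      div_nonneg (by positivity) (sub_nonneg.2 (hx j.castSucc_lt_succ).le)
    rw [eulerianDensity, ENNReal.ofReal_sum_of_nonneg fun j _ =>
      indicator_nonneg (fun _ _ => hnonneg j) y]
    exact Finset.sum_congr rfl fun j _ =>
      congrFun (indicator_comp_of_zero (g := ENNReal.ofReal) ENNReal.ofReal_zero).symm y
  ext s hs
  rw [labelMeasure_map_labelPosition_apply hx hs, eulerianMeasure, withDensity_apply _ hs]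
  simp only [hdensity]
  rw [lintegral_finsetSum _ fun j _ => measurable_const.indicator measurableSet_Ico]
  refine Finset.sum_congr rfl fun j _ => ?_
  rw [lintegral_indicator_const measurableSet_Ico, Measure.restrict_apply measurableSet_Ico]

theorem wassersteinEulerian_eq_lintegral (hx : StrictMono (x · t)) (hz : StrictMono (z · t)) :
    wassersteinEulerian x z t =
      ∫⁻ q, ‖labelPosition x t q - labelPosition z t q‖ₑ ∂labelMeasure N := by
  rw [wassersteinEulerian, eulerianMeasure_eq_map hx, eulerianMeasure_eq_map hz]
  exact wassersteinOne_map_map (measurable_labelPosition x t) (measurable_labelPosition z t)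
    (monovary_labelPosition hx.monotone hz.monotone)

theorem lintegral_labelMeasure_fst (f : Fin N → ℝ≥0∞) :
    ∫⁻ q, f q.1 ∂labelMeasure N = ENNReal.ofReal (1 / N) * ∑ j, f j := by
  rw [labelMeasure, lintegral_smul_measure, lintegral_prod _ (by fun_prop), lintegral_count,
    tsum_fintype, smul_eq_mul]
  simp

theorem abs_labelPosition_sub_le (x z : Fin (N + 1) → ℝ → ℝ) (s t : ℝ) (q : Fin N × unitInterval) :
    |labelPosition x t q - labelPosition z t q| ≤ |labelPosition x s q - labelPosition z s q| +
      (|x q.1.castSucc t - z q.1.castSucc t - (x q.1.castSucc s - z q.1.castSucc s)| +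
        |x q.1.succ t - z q.1.succ t - (x q.1.succ s - z q.1.succ s)|) := by
  let e (i : Fin (N + 1)) : ℝ := x i t - z i t - (x i s - z i s)
  obtain ⟨j, θ, hθ⟩ := q
  have hinterp : labelPosition x t (j, ⟨θ, hθ⟩) - labelPosition z t (j, ⟨θ, hθ⟩) =
      labelPosition x s (j, ⟨θ, hθ⟩) - labelPosition z s (j, ⟨θ, hθ⟩) +
        ((1 - θ) * e j.castSucc + θ * e j.succ) := by
    simp only [labelPosition, gap, e]
    ring
  rw [hinterp]
  refine (abs_add_le _ _).trans (add_le_add_right ((abs_add_le _ _).trans ?_) _)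
  rw [abs_mul, abs_mul, abs_of_nonneg hθ.1, abs_of_nonneg (sub_nonneg.2 hθ.2)]
  exact add_le_add (mul_le_of_le_one_left (abs_nonneg _) (sub_le_self _ hθ.1))
    (mul_le_of_le_one_left (abs_nonneg _) hθ.2)

theorem wassersteinEulerian_le_add {s : ℝ} (hxs : StrictMono (x · s)) (hzs : StrictMono (z · s))
    (hxt : StrictMono (x · t)) (hzt : StrictMono (z · t)) :
    wassersteinEulerian x z t ≤ wassersteinEulerian x z s +
      ENNReal.ofReal (2 / N * ∑ i, |x i t - z i t - (x i s - z i s)|) := by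
  set e : Fin (N + 1) → ℝ := fun i => x i t - z i t - (x i s - z i s)
  have hsum : ∑ j : Fin N, (|e j.castSucc| + |e j.succ|) ≤ 2 * ∑ i, |e i| := by
    rw [Finset.sum_add_distrib, two_mul]
    refine add_le_add ?_ ?_
    · rw [Fin.sum_univ_castSucc]
      exact le_add_of_nonneg_right (abs_nonneg _)
    · rw [Fin.sum_univ_succ]
      exact le_add_of_nonneg_left (abs_nonneg _)
  rw [wassersteinEulerian_eq_lintegral hxt hzt, wassersteinEulerian_eq_lintegral hxs hzs]
  calc _ ≤ ∫⁻ q, (‖labelPosition x s q - labelPosition z s q‖ₑ +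
          ENNReal.ofReal (|e q.1.castSucc| + |e q.1.succ|)) ∂labelMeasure N := by
        refine lintegral_mono fun q => ?_
        rw [Real.enorm_eq_ofReal_abs, Real.enorm_eq_ofReal_abs,
          ← ENNReal.ofReal_add (by positivity) (by positivity)]
        exact ENNReal.ofReal_le_ofReal (abs_labelPosition_sub_le x z s t q)
    _ = _ + ENNReal.ofReal (1 / N * ∑ j : Fin N, (|e j.castSucc| + |e j.succ|)) := by
        rw [lintegral_add_right _ (by fun_prop), lintegral_labelMeasure_fst fun j =>
          ENNReal.ofReal (|e j.castSucc| + |e j.succ|), ENNReal.ofReal_mul (by positivity),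
          ENNReal.ofReal_sum_of_nonneg fun j _ => by positivity]
    _ ≤ _ := by
        refine add_le_add_right (ENNReal.ofReal_le_ofReal ?_) _
        refine (mul_le_mul_of_nonneg_left hsum (by positivity)).trans_eq ?_
        ring

theorem IsFtLSolution.wassersteinEulerian_le {v : ℝ → ℝ} {L : ℝ≥0} (hx : IsFtLSolution v N x)
    (hz : IsFtLSolution v N z) (hlip : LipschitzOnWith L v (Icc 0 1))
    (hv : AntitoneOn v (Icc 0 1)) (hN : 1 ≤ N) (ht : 0 ≤ t) :
    wassersteinEulerian x z t ≤ wassersteinEulerian x z 0 +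
      ENNReal.ofReal (2 * L * t * initialGapDifference x z) := by
  refine (wassersteinEulerian_le_add (hx.strictMono hv hN le_rfl) (hz.strictMono hv hN le_rfl)
    (hx.strictMono hv hN ht) (hz.strictMono hv hN ht)).trans ?_
  refine add_le_add_right (ENNReal.ofReal_le_ofReal ?_) _
  refine (mul_le_mul_of_nonneg_left (hx.sum_abs_sub_sub_initial_le hz hlip hv hN ht)
    (by positivity)).trans_eq ?_
  have : (N : ℝ) ≠ 0 := by positivity
  field_simp

end Labels

section LOne

/-- The right-continuous unit step at `a`, used to write piecewise constant functions. -/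
noncomputable def unitStep (a : ℝ) : ℝ → ℝ := (Ici a).indicator 1

theorem unitStep_sub_unitStep {a b : ℝ} (hab : a ≤ b) :
    unitStep a - unitStep b = (Ico a b).indicator 1 := by
  rw [unitStep, unitStep, ← indicator_sdiff (Ici_subset_Ici.2 hab), Ici_sdiff_Ici]

theorem aestronglyMeasurable_unitStep_sub (a b : ℝ) :
    AEStronglyMeasurable (unitStep a - unitStep b) :=
  ((measurable_one.indicator measurableSet_Ici).sub
    (measurable_one.indicator measurableSet_Ici)).aestronglyMeasurable

theorem eLpNorm_unitStep_sub (a b : ℝ) :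
    eLpNorm (unitStep a - unitStep b) 1 volume = ENNReal.ofReal |a - b| := by
  wlog hab : a ≤ b generalizing a b
  · rw [eLpNorm_sub_comm, this b a (le_of_not_ge hab), abs_sub_comm]
  rw [unitStep_sub_unitStep hab, abs_sub_comm, abs_of_nonneg (sub_nonneg.2 hab), ← Real.volume_Ico]
  change eLpNorm ((Ico a b).indicator fun _ => (1 : ℝ)) 1 volume = _
  rw [eLpNorm_indicator_const measurableSet_Ico one_ne_zero ENNReal.one_ne_top]
  simp only [enorm_one, ENNReal.toReal_one, div_one, ENNReal.rpow_one, one_mul]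

theorem eLpNorm_sum_smul_unitStep_sub_le {ι : Type*} [Fintype ι] (c a b : ι → ℝ) :
    eLpNorm (∑ i, c i • (unitStep (a i) - unitStep (b i))) 1 volume ≤
      ENNReal.ofReal (∑ i, |c i| * |a i - b i|) := by
  rw [ENNReal.ofReal_sum_of_nonneg fun i _ => by positivity]
  refine (eLpNorm_sum_le (fun i _ =>
    (aestronglyMeasurable_unitStep_sub _ _).const_smul (c i)) le_rfl).trans
    (Finset.sum_le_sum fun i _ => ?_)
  rw [eLpNorm_const_smul, eLpNorm_unitStep_sub, Real.enorm_eq_ofReal_abs,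
    ENNReal.ofReal_mul (abs_nonneg _)]

variable {N : ℕ} {x z : Fin (N + 1) → ℝ → ℝ} {t : ℝ}

/-- The jump of the Eulerian discrete density at the position of each vehicle. -/
noncomputable def densityJump (x : Fin (N + 1) → ℝ → ℝ) (t : ℝ) (i : Fin (N + 1)) : ℝ :=
  extendedDensity x t i.succ - extendedDensity x t i.castSucc

theorem sum_vehicleDensity_smul_sub {E : Type*} [AddCommGroup E] [Module ℝ E]
    (x : Fin (N + 1) → ℝ → ℝ) (t : ℝ) (h : Fin (N + 1) → E) :
    ∑ j : Fin N, vehicleDensity x t j.castSucc • (h j.castSucc - h j.succ) =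
      ∑ i, densityJump x t i • h i := by
  have hcast : ∑ i : Fin (N + 1), extendedDensity x t i.castSucc • h i =
      ∑ j : Fin N, vehicleDensity x t j.castSucc • h j.succ := by
    simp only [Fin.sum_univ_succ, extendedDensity, Fin.castSucc_zero, Fin.cons_zero, zero_smul,
      zero_add, ← Fin.succ_castSucc, Fin.cons_succ]
  have hsucc : ∑ i : Fin (N + 1), extendedDensity x t i.succ • h i =
      ∑ j : Fin N, vehicleDensity x t j.castSucc • h j.castSucc := by
    simp only [Fin.sum_univ_castSucc, extendedDensity, Fin.cons_succ, vehicleDensity_last,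
      zero_smul, add_zero]
  simp only [densityJump, sub_smul, smul_sub, Finset.sum_sub_distrib, hcast, hsucc]

theorem eulerianDensity_eq_sum_smul_unitStep_sub (hx : Monotone (x · t)) :
    eulerianDensity x t = ∑ j : Fin N,
      vehicleDensity x t j.castSucc • (unitStep (x j.castSucc t) - unitStep (x j.succ t)) := by
  ext y
  rw [eulerianDensity, Finset.sum_apply]
  refine Finset.sum_congr rfl fun j _ => ?_
  rw [unitStep_sub_unitStep (hx j.castSucc_le_succ), Pi.smul_apply, vehicleDensity_castSucc,
    smul_eq_mul, ← indicator_const_mul]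
  simp only [discreteDensity, gap, Pi.one_apply, mul_one]

theorem eulerianDensity_sub_eulerianDensity (hx : Monotone (x · t)) (hz : Monotone (z · t)) :
    eulerianDensity x t - eulerianDensity z t =
      ∑ i, densityJump x t i • (unitStep (x i t) - unitStep (z i t)) +
      ∑ j : Fin N, (vehicleDensity x t j.castSucc - vehicleDensity z t j.castSucc) •
        (unitStep (z j.castSucc t) - unitStep (z j.succ t)) := by
  simp only [sub_smul, Finset.sum_sub_distrib]
  rw [sum_vehicleDensity_smul_sub x t fun i => unitStep (z i t),
    ← eulerianDensity_eq_sum_smul_unitStep_sub hz, eulerianDensity_eq_sum_smul_unitStep_sub hx,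
    sum_vehicleDensity_smul_sub x t fun i => unitStep (x i t)]
  simp only [smul_sub, Finset.sum_sub_distrib]
  abel

theorem lOneEulerian_le (hx : Monotone (x · t)) (hz : Monotone (z · t)) :
    lOneEulerian x z t ≤ ENNReal.ofReal (∑ i, |densityJump x t i| * |x i t - z i t| +
      ∑ j : Fin N, |vehicleDensity x t j.castSucc - vehicleDensity z t j.castSucc| *
        |gap z j t|) := by
  have hgap (j : Fin N) : |gap z j t| = |z j.castSucc t - z j.succ t| := abs_sub_comm _ _
  simp only [hgap]
  rw [ENNReal.ofReal_add (Finset.sum_nonneg fun i _ => by positivity)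
    (Finset.sum_nonneg fun i _ => by positivity)]
  change eLpNorm (eulerianDensity x t - eulerianDensity z t) 1 volume ≤ _
  rw [eulerianDensity_sub_eulerianDensity hx hz]
  refine (eLpNorm_add_le ?_ ?_ le_rfl).trans (add_le_add (eLpNorm_sum_smul_unitStep_sub_le _ _ _)
    (eLpNorm_sum_smul_unitStep_sub_le _ _ _))
  all_goals exact Finset.aestronglyMeasurable_sum _ fun i _ =>
    (aestronglyMeasurable_unitStep_sub _ _).const_smul _

theorem IsFtLSolution.lOneEulerian_le {v : ℝ → ℝ} (hx : IsFtLSolution v N x)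
    (hz : IsFtLSolution v N z) (hv : AntitoneOn v (Icc 0 1)) (hN : 1 ≤ N)
    (hlead : x (Fin.last N) 0 = z (Fin.last N) 0) (ht : 0 ≤ t) {M : ℝ}
    (hM : discreteVariation (extendedDensity x t) ≤ M) :
    lOneEulerian x z t ≤ ENNReal.ofReal ((M + 1) * initialGapDifference x z) := by
  have hjump : ∑ i, |densityJump x t i| * |x i t - z i t| ≤ M * initialGapDifference x z :=
    calc _ ≤ ∑ i, |densityJump x t i| * initialGapDifference x z := by
          gcongr with i
          exact hx.abs_sub_le hz hv hN hlead i ht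
      _ = discreteVariation (extendedDensity x t) * initialGapDifference x z :=
          (Finset.sum_mul _ _ _).symm
      _ ≤ _ := mul_le_mul_of_nonneg_right hM (Finset.sum_nonneg fun _ _ => abs_nonneg _)
  have hdensity (j : Fin N) :
      |vehicleDensity x t j.castSucc - vehicleDensity z t j.castSucc| * |gap z j t| ≤
        |gap x j t - gap z j t| := by
    rw [vehicleDensity_castSucc, vehicleDensity_castSucc, abs_of_pos (hz.gap_pos hv hN j ht)]
    exact abs_div_sub_div_mul_le (by positivity) (hx.le_gap hv hN j ht)
      (hz.gap_pos hv hN j ht)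
  refine (_root_.lOneEulerian_le (hx.strictMono hv hN ht).monotone
    (hz.strictMono hv hN ht).monotone).trans (ENNReal.ofReal_le_ofReal ?_)
  rw [add_mul, one_mul]
  exact add_le_add hjump
    ((Finset.sum_le_sum fun j _ => hdensity j).trans (hx.sum_abs_gap_sub_gap_le hz hv hN ht))

theorem eulerianDensity_apply (hx : StrictMono (x · t)) (i : Fin (N + 1)) :
    eulerianDensity x t (x i t) = vehicleDensity x t i := by
  have hmem (j : Fin N) : x i t ∈ Ico (x j.castSucc t) (x j.succ t) ↔ j.castSucc = i := by
    rw [mem_Ico, hx.le_iff_le, hx.lt_iff_lt, ← Fin.le_castSucc_iff, le_antisymm_iff]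
  simp only [eulerianDensity, indicator_apply, hmem]
  cases i using Fin.lastCases with
  | last => simp [Fin.castSucc_ne_last]
  | cast k => simp [discreteDensity, gap]

theorem eulerianDensity_of_lt (hx : Monotone (x · t)) {y : ℝ} (hy : y < x 0 t) :
    eulerianDensity x t y = 0 :=
  Finset.sum_eq_zero fun _ _ => indicator_of_notMem
    (fun hmem => (hy.trans_le (hx (Fin.zero_le _))).not_ge hmem.1) _

theorem ofReal_discreteVariation_comp_le {f : ℝ → ℝ} {n : ℕ} {p : Fin (n + 1) → ℝ}
    (hp : Monotone p) : ENNReal.ofReal (discreteVariation (f ∘ p)) ≤ eVariationOn f univ := by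
  have hval (i : Fin (n + 1)) : Fin.clamp i n = i := by
    ext
    simp [Fin.is_le i]
  refine le_of_eq_of_le ?_ (eVariationOn.sum_le (f := f) (n := n) (u := fun k => p (Fin.clamp k n))
    (hp.comp Fin.clamp_monotone) fun _ => mem_univ _)
  rw [discreteVariation, ENNReal.ofReal_sum_of_nonneg fun j _ => abs_nonneg _, Finset.sum_range]
  refine Finset.sum_congr rfl fun j _ => ?_
  have hsucc := hval j.succ
  have hcast := hval j.castSucc
  rw [Fin.val_succ] at hsucc
  rw [Fin.val_castSucc] at hcast
  rw [hsucc, hcast, edist_dist, Real.dist_eq, Function.comp_apply, Function.comp_apply]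

theorem ofReal_discreteVariation_extendedDensity_le (hx : StrictMono (x · 0)) :
    ENNReal.ofReal (discreteVariation (extendedDensity x 0)) ≤ initialTotalVariation x := by
  let p : Fin (N + 2) → ℝ := Fin.cons (x 0 0 - 1) (x · 0)
  have hp : Monotone p := by
    refine Fin.monotone_iff_le_succ.2 fun i => ?_
    cases i using Fin.cases with
    | zero => simp [p]
    | succ j => exact hx.monotone j.castSucc_le_succ
  have hdensity : extendedDensity x 0 = eulerianDensity x 0 ∘ p := by
    ext i
    cases i using Fin.cases with
    | zero => exact (eulerianDensity_of_lt hx.monotone (sub_one_lt _)).symm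
    | succ i => exact (eulerianDensity_apply hx i).symm
  rw [hdensity]
  exact ofReal_discreteVariation_comp_le hp

end LOne

section Stability

theorem exists_strictMono_tendsto_diagonal {X : Type*} [TopologicalSpace X]
    {a : X} [(𝓝 a).IsCountablyGenerated] {u : ℕ → ℕ → X}
    (hu : ∀ k, Tendsto (u k) atTop (𝓝 a)) :
    ∃ φ : ℕ → ℕ, StrictMono φ ∧ Tendsto (fun k => u k (φ k)) atTop (𝓝 a) := by
  obtain ⟨s, hs⟩ := (𝓝 a).exists_antitone_basis
  obtain ⟨φ, hφ, hmem⟩ := extraction_forall_of_eventually fun k => (hu k).eventually_mem (hs.mem k)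
  exact ⟨φ, hφ, hs.tendsto hmem⟩

theorem tendsto_biSup_of_le_ofReal_mul {s : Set ℝ} {f : ℕ → ℝ → ℝ≥0∞} {S : ℕ → ℝ} {M : ℝ}
    (hS : Tendsto S atTop (𝓝 0)) (hf : ∀ N, 1 ≤ N → ∀ t ∈ s, f N t ≤ ENNReal.ofReal (M * S N)) :
    Tendsto (fun N => ⨆ t ∈ s, f N t) atTop (𝓝 0) := by
  have hlim : Tendsto (fun N => ENNReal.ofReal (M * S N)) atTop (𝓝 0) := by
    simpa using ENNReal.tendsto_ofReal (hS.const_mul M)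
  refine tendsto_of_tendsto_of_tendsto_of_le_of_le' tendsto_const_nhds hlim
    (Eventually.of_forall fun _ => zero_le) ?_
  filter_upwards [eventually_ge_atTop 1] with N hN
  exact iSup₂_le (hf N hN)

theorem exists_strictMono_tendsto_biSup_Icc {f : ℕ → ℝ → ℝ≥0∞}
    (hf : ∀ δ > 0, Tendsto (fun N => ⨆ t ∈ Ici δ, f N t) atTop (𝓝 0)) (T : ℝ) :
    ∃ φ : ℕ → ℕ, StrictMono φ ∧
      Tendsto (fun k : ℕ => ⨆ t ∈ Icc (1 / (k : ℝ)) T, f (φ k) t) atTop (𝓝 0) := by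
  obtain ⟨φ, hφ, hlim⟩ := exists_strictMono_tendsto_diagonal fun k : ℕ =>
    hf (1 / ((k : ℝ) + 1)) (by positivity)
  refine ⟨φ, hφ, tendsto_nhds_bot_mono hlim ?_⟩
  filter_upwards [eventually_ge_atTop 1] with k hk
  refine biSup_mono fun t ht => le_trans ?_ ht.1
  gcongr
  exact le_add_of_nonneg_right zero_le_one

variable {v : ℝ → ℝ} {L : ℝ≥0} {x z : (N : ℕ) → Fin (N + 1) → ℝ → ℝ}

theorem tendsto_biSup_lOneEulerian_of_initialTotalVariation_le (hv : AntitoneOn v (Icc 0 1))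
    (hx : ∀ N, 1 ≤ N → IsFtLSolution v N (x N)) (hz : ∀ N, 1 ≤ N → IsFtLSolution v N (z N))
    (hlead : ∀ N, 1 ≤ N → x N (Fin.last N) 0 = z N (Fin.last N) 0)
    (hS : Tendsto (fun N => initialGapDifference (x N) (z N)) atTop (𝓝 0)) {C : ℝ≥0}
    (hC : ∀ N, 1 ≤ N → initialTotalVariation (x N) ≤ C) :
    Tendsto (fun N => ⨆ t ∈ Ici (0 : ℝ), lOneEulerian (x N) (z N) t) atTop (𝓝 0) := by
  refine tendsto_biSup_of_le_ofReal_mul (M := C + 1) hS fun N hN t ht => ?_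
  refine (hx N hN).lOneEulerian_le (hz N hN) hv hN (hlead N hN) ht
    (((hx N hN).discreteVariation_extendedDensity_le_initial hv hN ht).trans ?_)
  refine (ENNReal.ofReal_le_ofReal_iff C.coe_nonneg).1 ?_
  rw [ENNReal.ofReal_coe_nnreal]
  exact (ofReal_discreteVariation_extendedDensity_le ((hx N hN).strictMono hv hN le_rfl)).trans
    (hC N hN)

theorem tendsto_biSup_lOneEulerian_of_velocityMonotonicity (hlip : LipschitzOnWith L v (Icc 0 1))
    (hv : AntitoneOn v (Icc 0 1)) {c : ℝ} (hc : c < 0)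
    (hd : ∀ᵐ r ∂volume.restrict (Icc (0 : ℝ) 1), deriv v r ≤ c) (hm : VelocityMonotonicity v)
    (hx : ∀ N, 1 ≤ N → IsFtLSolution v N (x N)) (hz : ∀ N, 1 ≤ N → IsFtLSolution v N (z N))
    (hxK : UniformlyBoundedInitialSupport x)
    (hlead : ∀ N, 1 ≤ N → x N (Fin.last N) 0 = z N (Fin.last N) 0)
    (hS : Tendsto (fun N => initialGapDifference (x N) (z N)) atTop (𝓝 0)) {δ : ℝ} (hδ : 0 < δ) :
    Tendsto (fun N => ⨆ t ∈ Ici δ, lOneEulerian (x N) (z N) t) atTop (𝓝 0) := by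
  obtain ⟨K, hK, hxK⟩ := hxK
  refine tendsto_biSup_of_le_ofReal_mul
    (M := 1 + 2 / -c * (Metric.diam K / δ + (v 0 - v 1)) + 1) hS fun N hN t ht => ?_
  have hdiam : x N (Fin.last N) 0 - x N 0 0 ≤ Metric.diam K :=
    (le_abs_self _).trans (Metric.dist_le_diam_of_mem hK (hxK N hN _) (hxK N hN _))
  refine (hx N hN).lOneEulerian_le (hz N hN) hv hN (hlead N hN) (hδ.le.trans ht)
    (((hx N hN).discreteVariation_extendedDensity_le hv hlip.continuousOn
      (fun a ha ha1 => antitoneOn_sub_comp_mul hlip hm ha ha1) hN (neg_pos.2 hc)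
      (fun r s hr hrs hs => mul_sub_le_map_sub hlip hd hr hrs hs) (hδ.trans_le ht)).trans ?_)
  have hc' := neg_pos.2 hc
  gcongr ?_ + 2 / -c * (?_ + _)
  · exact le_rfl
  · exact div_le_div₀ Metric.diam_nonneg hdiam hδ ht

end Stability

theorem theorem2_general {v : ℝ → ℝ} {L : ℝ≥0} (hlip : LipschitzOnWith L v (Icc 0 1))
    (hv : AntitoneOn v (Icc 0 1)) {x z : (N : ℕ) → Fin (N + 1) → ℝ → ℝ}
    (hx : ∀ N, 1 ≤ N → IsFtLSolution v N (x N)) (hz : ∀ N, 1 ≤ N → IsFtLSolution v N (z N)) :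
    (∀ T, ∀ N, 1 ≤ N → (⨆ t ∈ Icc 0 T, wassersteinEulerian (x N) (z N) t) ≤
      wassersteinEulerian (x N) (z N) 0 +
        ENNReal.ofReal (2 * L * T * initialGapDifference (x N) (z N))) ∧
    ((∀ N, 1 ≤ N → x N (Fin.last N) 0 = z N (Fin.last N) 0) →
      Tendsto (fun N => initialGapDifference (x N) (z N)) atTop (𝓝 0) →
      ((∃ C : ℝ≥0, ∀ N, 1 ≤ N → initialTotalVariation (x N) ≤ C) →
        Tendsto (fun N => ⨆ t ∈ Ici (0 : ℝ), lOneEulerian (x N) (z N) t) atTop (𝓝 0)) ∧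
      (UniformlyBoundedInitialSupport x →
        (∃ c < 0, ∀ᵐ r ∂volume.restrict (Icc (0 : ℝ) 1), deriv v r ≤ c) →
        VelocityMonotonicity v → ∀ δ > 0,
          Tendsto (fun N => ⨆ t ∈ Ici δ, lOneEulerian (x N) (z N) t) atTop (𝓝 0))) := by
  refine ⟨fun T N hN => iSup₂_le fun t ht => ?_, fun hlead hS => ⟨?_, ?_⟩⟩
  · have hS : 0 ≤ initialGapDifference (x N) (z N) := Finset.sum_nonneg fun _ _ => abs_nonneg _
    refine ((hx N hN).wassersteinEulerian_le (hz N hN) hlip hv hN ht.1).trans ?_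
    gcongr
    exact ht.2
  · rintro ⟨C, hC⟩
    exact tendsto_biSup_lOneEulerian_of_initialTotalVariation_le hv hx hz hlead hS hC
  · rintro hxK ⟨c, hc, hd⟩ hm δ hδ
    exact tendsto_biSup_lOneEulerian_of_velocityMonotonicity hlip hv hc hd hm hx hz hxK hlead hS hδ

theorem theorem2 (v : ℝ → ℝ) (L : ℝ≥0) (hv : VelocityAssumption v L)
    (x z : (N : ℕ) → Fin (N + 1) → ℝ → ℝ)
    (hx : ∀ N : ℕ, 1 ≤ N → IsFtLSolution v N (x N))
    (hz : ∀ N : ℕ, 1 ≤ N → IsFtLSolution v N (z N))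
    (hxK : UniformlyBoundedInitialSupport x) (hzK : UniformlyBoundedInitialSupport z) :
    (∀ T : ℝ, 0 < T → ∀ N : ℕ, 1 ≤ N →
      (⨆ t ∈ Icc (0 : ℝ) T, wassersteinEulerian (x N) (z N) t) ≤
        wassersteinEulerian (x N) (z N) 0 +
          ENNReal.ofReal (2 * (L : ℝ) * T * initialGapDifference (x N) (z N))) ∧
    ((∀ N : ℕ, 1 ≤ N → x N (Fin.last N) 0 = z N (Fin.last N) 0) →
      Tendsto (fun N : ℕ => initialGapDifference (x N) (z N)) atTop (𝓝 0) →
      ((∃ C : ℝ, 0 < C ∧ ∀ N : ℕ, 1 ≤ N →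
          initialTotalVariation (x N) < ENNReal.ofReal C ∧
          initialTotalVariation (z N) < ENNReal.ofReal C) →
        ∀ T : ℝ, 0 < T →
          Tendsto (fun N : ℕ => ⨆ t ∈ Icc (0 : ℝ) T, lOneEulerian (x N) (z N) t)
            atTop (𝓝 0)) ∧
      (VelocityMonotonicity v →
        ∀ T : ℝ, 0 < T → ∃ φ : ℕ → ℕ, StrictMono φ ∧
          Tendsto (fun k : ℕ =>
              ⨆ t ∈ Icc (1 / (k : ℝ)) T, lOneEulerian (x (φ k)) (z (φ k)) t)
            atTop (𝓝 0))) := by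
  have h := theorem2_general hv.lipschitz hv.antitoneOn hx hz
  refine ⟨fun T _ N hN => h.1 T N hN, fun hlead hS => ⟨fun ⟨C, _, hC⟩ T _ => ?_, fun hm T _ =>
    exists_strictMono_tendsto_biSup_Icc ((h.2 hlead hS).2 hxK hv.deriv_le hm) T⟩⟩
  exact tendsto_nhds_bot_mono' ((h.2 hlead hS).1 ⟨C.toNNReal, fun N hN => (hC N hN).1.le⟩)
    fun N => biSup_mono fun t ht => ht.1
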